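/- Let $m\ge 0$ be an integer and let $D=\mathbb{C}[x_1,\ldots,x_m]\langle\partial_1,\ldots,\partial_m\rangle$ be the Weyl algebra, i.e. the ring of differential operators with polynomial coefficients. Every $P\in D$ has a unique normally ordered expression $P=\sum c_{\alpha\beta}x^\alpha\partial^\beta$. Given a term order $<$ on the monomials $x^\alpha\xi^\beta$ of the commutative polynomial ring $\mathbb{C}[x_1,\ldots,x_m,\xi_1,\ldots,\xi_m]$ (a total order compatible with multiplication for which $1$ is the smallest monomial), the initial monomial $\mathrm{in}_<(P)$ of $P\neq 0$ is the largest monomial $x^\alpha\xi^\beta$ with $c_{\alpha\beta}\neq0$, and $\mathrm{in}_<(0)=0$. For a left ideal $I$ of $D$, $\mathrm{in}_<(I)$ is the ideal of $\mathbb{C}[x,\xi]$ generated by all $\mathrm{in}_<(P)$, $P\in I$. A finite set $G\subset D$ is a Gröbner basis of $I$ with respect to $<$ if $G$ generates $I$ as a left ideal and $\{\mathrm{in}_<(g): g\in G\}$ generates $\mathrm{in}_<(I)$. Let $a_1,\ldots,a_m,b_1,\ldots,b_m,c\in\mathbb{C}$ be arbitrary (no condition on the parameters), let $\theta_i=x_i\partial_i$,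 put $$\ell_i^B=\theta_i(\theta_1+\cdots+\theta_m+c-1)-x_i(\theta_i+a_i)(\theta_i+b_i)\qquad(i=1,\ldots,m),$$ and let $I_B(m)=D\cdot\{\ell_1^B,\ldots,\ell_m^B\}$ be the left ideal they generate. Let $<'$ be any term order on the monomials $x^\alpha\xi^\beta$, and define the term order $<_{(\mathbf 0,\mathbf 1)}$ by: $x^\alpha\xi^\beta<_{(\mathbf 0,\mathbf 1)}x^{\alpha'}\xi^{\beta'}$ if and only if one of the following holds: 1. $\sum_i\beta_i<\sum_i\beta_i'$; 2. $\sum_i\beta_i=\sum_i\beta_i'$ and $\sum_i\alpha_i<\sum_i\alpha_i'$; 3. $\sum_i\beta_i=\sum_i\beta_i'$, $\sum_i\alpha_i=\sum_i\alpha_i'$ and $x^\alpha\xi^\beta<'x^{\alpha'}\xi^{\beta'}$. Then $\{\ell_1^B,\ldots,\ell_m^B\}$ is a Gröbner basis of $I_B(m)$ with respect to $<_{(\mathbf 0,\mathbf 1)}$. -/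

import Mathlib

noncomputable section

namespace Lauricella

open MvPolynomial

/-! ## The Weyl algebra -/

/-- Multiplication by the coordinate `x i`, as an operator on polynomials. -/
def mulXEnd (m : ℕ) (i : Fin m) : Module.End ℂ (MvPolynomial (Fin m) ℂ) :=
  LinearMap.mulLeft ℂ (X i)

/-- The partial derivative with respect to `x i`, as an operator on polynomials. -/
def derivEnd (m : ℕ) (i : Fin m) : Module.End ℂ (MvPolynomial (Fin m) ℂ) :=
  (pderiv i : Derivation ℂ (MvPolynomial (Fin m) ℂ) (MvPolynomial (Fin m) ℂ)).toLinearMap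

/-- The Weyl algebra `D = ℂ[x₁, …, xₘ]⟨∂₁, …, ∂ₘ⟩`: the ring of differential operators with
polynomial coefficients, that is, the algebra of operators on `ℂ[x₁, …, xₘ]` generated by the
multiplications by the coordinates and by the partial derivatives. -/
abbrev Weyl (m : ℕ) : Type :=
  Algebra.adjoin ℂ (Set.range (mulXEnd m) ∪ Set.range (derivEnd m))

/-- The element `xᵢ` of the Weyl algebra. -/
def x {m : ℕ} (i : Fin m) : Weyl m :=
  ⟨mulXEnd m i, Algebra.subset_adjoin (Or.inl ⟨i, rfl⟩)⟩

/-- The element `∂ᵢ` of the Weyl algebra. -/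
def del {m : ℕ} (i : Fin m) : Weyl m :=
  ⟨derivEnd m i, Algebra.subset_adjoin (Or.inr ⟨i, rfl⟩)⟩

/-- The Euler operator `θᵢ = xᵢ ∂ᵢ`. -/
def theta {m : ℕ} (i : Fin m) : Weyl m := x i * del i

theorem x_apply {m : ℕ} (i : Fin m) (f : MvPolynomial (Fin m) ℂ) :
    (x i).1 f = X i * f := rfl

theorem del_apply {m : ℕ} (i : Fin m) (f : MvPolynomial (Fin m) ℂ) :
    (del i).1 f = pderiv i f := rfl

theorem weyl_ext {m : ℕ} {P Q : Weyl m} (h : ∀ f, P.1 f = Q.1 f) : P = Q :=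
  Subtype.ext (LinearMap.ext h)

theorem mul_apply {m : ℕ} (P Q : Weyl m) (f : MvPolynomial (Fin m) ℂ) :
    (P * Q).1 f = P.1 (Q.1 f) := rfl

theorem x_commute {m : ℕ} (i j : Fin m) : Commute (x i : Weyl m) (x j) :=
  weyl_ext fun f => by
    rw [mul_apply, mul_apply, x_apply, x_apply, x_apply, x_apply, mul_left_comm]

theorem del_commute {m : ℕ} (i j : Fin m) : Commute (del i : Weyl m) (del j) :=
  weyl_ext fun f => by
    classical
    rw [mul_apply, mul_apply, del_apply, del_apply, del_apply, del_apply]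
    have h : ⁅(pderiv i : Derivation ℂ (MvPolynomial (Fin m) ℂ) (MvPolynomial (Fin m) ℂ)),
        (pderiv j : Derivation ℂ (MvPolynomial (Fin m) ℂ) (MvPolynomial (Fin m) ℂ))⁆ = 0 := by
      apply MvPolynomial.derivation_ext
      intro k
      simp only [Derivation.commutator_apply, pderiv_X, Derivation.coe_zero, Pi.zero_apply]
      have hd : ∀ (a b : Fin m), pderiv a (Pi.single (M := fun _ => MvPolynomial (Fin m) ℂ) b 1 k)
          = 0 := by
        intro a b
        rw [Pi.single_apply]
        split_ifs
        · exact pderiv_one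
        · exact map_zero _
      rw [hd, hd, sub_zero]
    have h' := congrArg (fun d => d f) h
    simpa [Derivation.commutator_apply, sub_eq_zero] using h'

/-! ## Normally ordered expressions -/

theorem pairwise_commute_pow {m : ℕ} {M : Type*} [Monoid M] (g : Fin m → M)
    (hg : ∀ i j, Commute (g i) (g j)) (β : Fin m → ℕ) :
    ((Finset.univ : Finset (Fin m)) : Set (Fin m)).Pairwise
      (Function.onFun Commute fun i => g i ^ β i) :=
  fun i _ j _ _ => (hg i j).pow_pow (β i) (β j)

/-- The product `∏ᵢ gᵢ ^ βᵢ` of powers of pairwise commuting elements. -/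
def commPow {m : ℕ} {M : Type*} [Monoid M] (g : Fin m → M) (hg : ∀ i j, Commute (g i) (g j))
    (β : Fin m → ℕ) : M :=
  Finset.univ.noncommProd (fun i => g i ^ β i) (pairwise_commute_pow g hg β)

theorem commPow_zero {m : ℕ} {M : Type*} [Monoid M] (g : Fin m → M)
    (hg : ∀ i j, Commute (g i) (g j)) : commPow g hg 0 = 1 := by
  unfold commPow
  rw [Finset.noncommProd_eq_pow_card _ _ _ 1 (by simp), one_pow]

theorem commPow_add_single {m : ℕ} {M : Type*} [Monoid M] (g : Fin m → M)
    (hg : ∀ i j, Commute (g i) (g j)) (β : Fin m → ℕ) (i : Fin m) :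
    commPow g hg (β + Pi.single i 1) = g i * commPow g hg β := by
  classical
  unfold commPow
  rw [← Finset.mul_noncommProd_erase _ (Finset.mem_univ i),
    ← Finset.mul_noncommProd_erase _ (Finset.mem_univ i), ← mul_assoc, ← pow_succ']
  congr 1
  · simp
  · apply Finset.noncommProd_congr rfl
    intro j hj
    simp [Finset.ne_of_mem_erase hj]

theorem pi_nat_induction {m : ℕ} {p : (Fin m → ℕ) → Prop} (h0 : p 0)
    (h1 : ∀ β i, p β → p (β + Pi.single i 1)) (β : Fin m → ℕ) : p β := by
  classical
  induction hn : ∑ i, β i generalizing β with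
  | zero =>
    have : β = 0 := by
      funext i
      exact (Finset.sum_eq_zero_iff.mp hn) i (Finset.mem_univ i)
    exact this ▸ h0
  | succ n ih =>
    obtain ⟨i, hi⟩ : ∃ i, β i ≠ 0 := by
      by_contra! h
      simp [h] at hn
    have hb : β = (β - Pi.single i 1) + Pi.single i 1 := by
      funext j
      by_cases hj : j = i
      · subst hj
        simp
        omega
      · simp [hj]
    rw [hb]
    apply h1
    apply ih
    rw [hb] at hn
    simp only [Pi.add_apply, Finset.sum_add_distrib] at hn
    simpa using hn

/-- The normally ordered monomial `x^α ∂^β`, where the exponent `γ = (α, β)` has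
`αᵢ = γ (inl i)` and `βᵢ = γ (inr i)`. -/
def monomialOp {m : ℕ} (γ : Fin m ⊕ Fin m →₀ ℕ) : Weyl m :=
  commPow x x_commute (fun i => γ (Sum.inl i)) * commPow del del_commute (fun i => γ (Sum.inr i))

/-- The linear map `∑ c_{αβ} x^α ξ^β ↦ ∑ c_{αβ} x^α ∂^β` from the polynomial ring `ℂ[x, ξ]`
(with `xᵢ = X (inl i)` and `ξᵢ = X (inr i)`) to the Weyl algebra. -/
def normalOrder (m : ℕ) : MvPolynomial (Fin m ⊕ Fin m) ℂ →ₗ[ℂ] Weyl m :=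
  (basisMonomials (Fin m ⊕ Fin m) ℂ).constr ℂ monomialOp

theorem normalOrder_monomial {m : ℕ} (γ : Fin m ⊕ Fin m →₀ ℕ) (c : ℂ) :
    normalOrder m (monomial γ c) = c • monomialOp γ := by
  have h : (monomial γ c : MvPolynomial (Fin m ⊕ Fin m) ℂ)
      = c • (basisMonomials (Fin m ⊕ Fin m) ℂ) γ := by
    simp [coe_basisMonomials, smul_monomial]
  rw [h, map_smul, normalOrder, Module.Basis.constr_basis]

theorem xPow_apply {m : ℕ} (α : Fin m → ℕ) (f : MvPolynomial (Fin m) ℂ) :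
    (commPow x x_commute α : Weyl m).1 f
      = monomial (Finsupp.equivFunOnFinite.symm α) 1 * f := by
  classical
  revert f
  induction α using pi_nat_induction with
  | h0 =>
    intro f
    rw [commPow_zero]
    have : Finsupp.equivFunOnFinite.symm (0 : Fin m → ℕ) = 0 := by ext; simp
    rw [this, monomial_zero', C_1, one_mul]
    rfl
  | h1 α i ih =>
    intro f
    have h : Finsupp.equivFunOnFinite.symm (α + Pi.single i 1)
        = Finsupp.single i 1 + Finsupp.equivFunOnFinite.symm α := by
      ext j
      simp [Finsupp.single_apply, Pi.single_apply, add_comm, eq_comm]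
    rw [commPow_add_single, mul_apply, ih, x_apply, h, X, ← mul_assoc, monomial_mul, one_mul]

theorem delPow_apply {m : ℕ} (β : Fin m → ℕ) (s : Fin m →₀ ℕ) :
    (commPow del del_commute β : Weyl m).1 (monomial s 1)
      = monomial (s - Finsupp.equivFunOnFinite.symm β)
          ((∏ i, (s i).descFactorial (β i) : ℕ) : ℂ) := by
  classical
  induction β using pi_nat_induction with
  | h0 =>
    rw [commPow_zero]
    have : Finsupp.equivFunOnFinite.symm (0 : Fin m → ℕ) = 0 := by ext; simp
    rw [this]
    simp
  | h1 β i ih =>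
    rw [commPow_add_single, mul_apply, ih, del_apply, pderiv_monomial]
    congr 1
    · congr 1
      ext j
      by_cases hj : j = i
      · subst hj
        simp [Nat.sub_sub]
      · simp [hj]
    · rw [← Nat.cast_mul]
      congr 1
      rw [← Finset.mul_prod_erase Finset.univ (fun k => (s k).descFactorial (β k))
          (Finset.mem_univ i)]
      refine Eq.trans ?_ (Finset.mul_prod_erase Finset.univ
          (fun k => (s k).descFactorial ((β + Pi.single i 1 : Fin m → ℕ) k)) (Finset.mem_univ i))
      have h : ∏ k ∈ Finset.univ.erase i, (s k).descFactorial ((β + Pi.single i 1 : Fin m → ℕ) k)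
          = ∏ k ∈ Finset.univ.erase i, (s k).descFactorial (β k) := by
        apply Finset.prod_congr rfl
        intro k hk
        simp [Finset.ne_of_mem_erase hk]
      rw [h]
      simp [Nat.descFactorial_succ]
      ring

theorem normalOrder_injective (m : ℕ) : Function.Injective (normalOrder m) := by
  classical
  rw [injective_iff_map_eq_zero]
  intro f hf
  by_contra hne
  obtain ⟨γ, hγ, hmin⟩ := Finset.exists_min_image f.support
    (fun δ => ∑ i, δ (Sum.inr i)) (by simpa [Finset.nonempty_iff_ne_empty] using hne)
  set s : Fin m →₀ ℕ := Finsupp.equivFunOnFinite.symm (fun i => γ (Sum.inr i)) with hs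
  set t : Fin m →₀ ℕ := Finsupp.equivFunOnFinite.symm (fun i => γ (Sum.inl i)) with ht
  have key : ∀ δ ∈ f.support, δ ≠ γ →
      coeff t ((coeff δ f • monomialOp δ : Weyl m).1 (monomial s 1)) = 0 := by
    intro δ hδ hδγ
    change coeff t (coeff δ f • (monomialOp δ : Weyl m).1 (monomial s 1)) = 0
    rw [monomialOp, mul_apply, delPow_apply, xPow_apply, monomial_mul, coeff_smul]
    by_cases hb : ∀ i, δ (Sum.inr i) = γ (Sum.inr i)
    · have h1 : s - Finsupp.equivFunOnFinite.symm (fun i => δ (Sum.inr i)) = 0 := by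
        ext i
        simp [hs, hb]
      rw [h1, add_zero, coeff_monomial, if_neg, smul_zero]
      intro h
      apply hδγ
      ext k
      rcases k with k | k
      · simpa [ht] using DFunLike.congr_fun h k
      · exact hb k
    · obtain ⟨i, hi⟩ : ∃ i, γ (Sum.inr i) < δ (Sum.inr i) := by
        by_contra! hle
        apply hb
        have := (Finset.sum_eq_sum_iff_of_le (fun i (_ : i ∈ Finset.univ) => hle i)).mp
          (le_antisymm (Finset.sum_le_sum fun i _ => hle i) (hmin δ hδ))
        exact fun i => this i (Finset.mem_univ i)
      have h0 : ∏ i, (s i).descFactorial (δ (Sum.inr i)) = 0 := by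
        apply Finset.prod_eq_zero (Finset.mem_univ i)
        rw [Nat.descFactorial_eq_zero_iff_lt]
        simpa [hs] using hi
      rw [h0]
      simp
  have hsum : normalOrder m f = ∑ δ ∈ f.support, coeff δ f • monomialOp δ := by
    conv_lhs => rw [f.as_sum]
    rw [map_sum]
    exact Finset.sum_congr rfl fun δ _ => normalOrder_monomial _ _
  have h0 : coeff t ((normalOrder m f).1 (monomial s 1)) = 0 := by
    rw [hf]
    exact coeff_zero t
  rw [hsum, AddSubmonoidClass.coe_finsetSum, LinearMap.sum_apply, coeff_sum,
    Finset.sum_eq_single_of_mem γ hγ key] at h0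
  change coeff t (coeff γ f • (monomialOp γ : Weyl m).1 (monomial s 1)) = 0 at h0
  have hss : s - Finsupp.equivFunOnFinite.symm (fun i => γ (Sum.inr i)) = 0 := by
    rw [← hs]
    simp
  rw [monomialOp, mul_apply, delPow_apply, xPow_apply, monomial_mul, coeff_smul, hss, add_zero,
    ← ht, coeff_monomial, if_pos rfl, one_mul, smul_eq_mul] at h0
  rcases mul_eq_zero.mp h0 with h | h
  · exact (mem_support_iff.mp hγ) h
  · rw [Nat.cast_eq_zero, Finset.prod_eq_zero_iff] at h
    obtain ⟨i, _, hi⟩ := h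
    rw [Nat.descFactorial_eq_zero_iff_lt] at hi
    simp [hs] at hi

theorem weyl_induction {m : ℕ} {p : Weyl m → Prop} (hx : ∀ i, p (x i)) (hdel : ∀ i, p (del i))
    (halg : ∀ c, p (algebraMap ℂ (Weyl m) c)) (hadd : ∀ P Q, p P → p Q → p (P + Q))
    (hmul : ∀ P Q, p P → p Q → p (P * Q)) (P : Weyl m) : p P := by
  obtain ⟨P, hP⟩ := P
  induction hP using Algebra.adjoin_induction with
  | mem Q hQ =>
    rcases hQ with ⟨i, rfl⟩ | ⟨i, rfl⟩
    · exact hx i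
    · exact hdel i
  | algebraMap c => exact halg c
  | add P Q hP hQ ihP ihQ => exact hadd ⟨P, hP⟩ ⟨Q, hQ⟩ ihP ihQ
  | mul P Q hP hQ ihP ihQ => exact hmul ⟨P, hP⟩ ⟨Q, hQ⟩ ihP ihQ

theorem mem_range_normalOrder {m : ℕ} (α β : Fin m → ℕ) :
    (commPow x x_commute α * commPow del del_commute β : Weyl m)
      ∈ LinearMap.range (normalOrder m) := by
  refine ⟨monomial (Finsupp.equivFunOnFinite.symm (Sum.elim α β)) 1, ?_⟩
  rw [normalOrder_monomial, one_smul, monomialOp]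
  rfl

theorem del_mul_xPow {m : ℕ} (i : Fin m) (α : Fin m → ℕ) :
    (del i * commPow x x_commute α : Weyl m)
      = commPow x x_commute α * del i
        + (α i : ℂ) • commPow x x_commute (α - Pi.single i 1) := by
  classical
  apply weyl_ext
  intro f
  change (del i * commPow x x_commute α : Weyl m).1 f
      = (commPow x x_commute α * del i : Weyl m).1 f
        + (α i : ℂ) • (commPow x x_commute (α - Pi.single i 1) : Weyl m).1 f
  have h : Finsupp.equivFunOnFinite.symm α - Finsupp.single i 1
      = Finsupp.equivFunOnFinite.symm (α - Pi.single i 1) := by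
    ext j
    simp [Finsupp.single_apply, Pi.single_apply, eq_comm]
  rw [mul_apply, mul_apply, xPow_apply, xPow_apply, xPow_apply, del_apply, del_apply, pderiv_mul,
    pderiv_monomial, h, add_comm, one_mul]
  congr 1
  rw [← smul_mul_assoc, smul_monomial]
  simp

theorem normalOrder_surjective (m : ℕ) : Function.Surjective (normalOrder m) := by
  classical
  rw [← LinearMap.range_eq_top, eq_top_iff]
  have hone : (1 : Weyl m) ∈ LinearMap.range (normalOrder m) := by
    have h := mem_range_normalOrder (0 : Fin m → ℕ) 0
    rwa [commPow_zero, commPow_zero, one_mul] at h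
  have key : ∀ T : Weyl m, (∀ α β : Fin m → ℕ,
      T * (commPow x x_commute α * commPow del del_commute β)
        ∈ LinearMap.range (normalOrder m)) →
      ∀ Q ∈ LinearMap.range (normalOrder m), T * Q ∈ LinearMap.range (normalOrder m) := by
    rintro T hT _ ⟨f, rfl⟩
    induction f using MvPolynomial.induction_on' with
    | monomial γ c =>
      rw [normalOrder_monomial, mul_smul_comm]
      exact Submodule.smul_mem _ _ (hT _ _)
    | add f g hf hg =>
      rw [map_add, mul_add]
      exact Submodule.add_mem _ hf hg
  have hmul : ∀ P : Weyl m, ∀ Q ∈ LinearMap.range (normalOrder m),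
      P * Q ∈ LinearMap.range (normalOrder m) := by
    intro P
    induction P using weyl_induction with
    | hx i =>
      apply key
      intro α β
      rw [← mul_assoc, ← commPow_add_single]
      exact mem_range_normalOrder _ _
    | hdel i =>
      apply key
      intro α β
      rw [← mul_assoc, del_mul_xPow, add_mul, mul_assoc, ← commPow_add_single, smul_mul_assoc]
      exact Submodule.add_mem _ (mem_range_normalOrder _ _)
        (Submodule.smul_mem _ _ (mem_range_normalOrder _ _))
    | halg c =>
      intro Q hQ
      rw [← Algebra.smul_def]
      exact Submodule.smul_mem _ _ hQ
    | hadd P P' hP hP' =>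
      intro Q hQ
      rw [add_mul]
      exact Submodule.add_mem _ (hP Q hQ) (hP' Q hQ)
    | hmul P P' hP hP' =>
      intro Q hQ
      rw [mul_assoc]
      exact hP _ (hP' Q hQ)
  intro P _
  have h := hmul P 1 hone
  rwa [mul_one] at h

/-- The normally ordered expression of a differential operator: the unique polynomial
`∑ c_{αβ} x^α ξ^β` such that `P = ∑ c_{αβ} x^α ∂^β`. -/
def symbol {m : ℕ} : Weyl m ≃ₗ[ℂ] MvPolynomial (Fin m ⊕ Fin m) ℂ :=
  (LinearEquiv.ofBijective (normalOrder m)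
    ⟨normalOrder_injective m, normalOrder_surjective m⟩).symm

theorem normalOrder_symbol {m : ℕ} (P : Weyl m) : normalOrder m (symbol P) = P :=
  (LinearEquiv.ofBijective (normalOrder m)
    ⟨normalOrder_injective m, normalOrder_surjective m⟩).apply_symm_apply P

/-! ## Initial monomials and Gröbner bases -/

open Classical in
/-- The initial monomial `in_<(P) = x^α ξ^β` of a differential operator `P`: the largest
monomial, with respect to the term order, that occurs in the normally ordered expression of `P`.
By convention `in_<(0) = 0`. -/
def initialMonomial {m : ℕ} (ord : MonomialOrder (Fin m ⊕ Fin m)) (P : Weyl m) :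
    MvPolynomial (Fin m ⊕ Fin m) ℂ :=
  if P = 0 then 0 else monomial (ord.degree (symbol P)) 1

/-- The initial ideal `in_<(I)` in `ℂ[x, ξ]` of a left ideal `I` of the Weyl algebra. -/
def initialIdeal {m : ℕ} (ord : MonomialOrder (Fin m ⊕ Fin m)) (I : Ideal (Weyl m)) :
    Ideal (MvPolynomial (Fin m ⊕ Fin m) ℂ) :=
  Ideal.span (initialMonomial ord '' (I : Set (Weyl m)))

/-- A finite set `G` is a Gröbner basis of the left ideal `I` if it generates `I` and the
initial monomials of its elements generate the initial ideal of `I`. (`Ideal` means left ideal.) -/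
structure IsGroebnerBasis {m : ℕ} (ord : MonomialOrder (Fin m ⊕ Fin m)) (G : Set (Weyl m))
    (I : Ideal (Weyl m)) : Prop where
  finite : G.Finite
  span_eq : Ideal.span G = I
  initialIdeal_eq : initialIdeal ord I = Ideal.span (initialMonomial ord '' G)

/-! ## The term order -/

/-- The exponents of monomials in `x, ξ`, to be ordered by total `ξ`-degree, then total
`x`-degree, then `tie`. -/
def OrderedExp {m : ℕ} (_tie : MonomialOrder (Fin m ⊕ Fin m)) : Type := Fin m ⊕ Fin m →₀ ℕ

instance {m : ℕ} (tie : MonomialOrder (Fin m ⊕ Fin m)) : AddCommMonoid (OrderedExp tie) :=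
  inferInstanceAs (AddCommMonoid (Fin m ⊕ Fin m →₀ ℕ))

/-- The key by which exponents are compared:
`(β₁ + ⋯ + βₘ, α₁ + ⋯ + αₘ, (α, β))`, lexicographically. -/
def orderKey {m : ℕ} (tie : MonomialOrder (Fin m ⊕ Fin m)) (γ : Fin m ⊕ Fin m →₀ ℕ) :
    ℕ ×ₗ (ℕ ×ₗ tie.syn) :=
  toLex (∑ i, γ (Sum.inr i), toLex (∑ i, γ (Sum.inl i), tie.toSyn γ))

theorem orderKey_injective {m : ℕ} (tie : MonomialOrder (Fin m ⊕ Fin m)) :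
    Function.Injective (orderKey tie) := by
  intro a b h
  have h1 := congrArg Prod.snd (toLex.injective h)
  have h2 := congrArg Prod.snd (toLex.injective h1)
  exact tie.toSyn.injective h2

instance {m : ℕ} (tie : MonomialOrder (Fin m ⊕ Fin m)) : LinearOrder (OrderedExp tie) :=
  LinearOrder.lift' (orderKey tie : OrderedExp tie → _) (orderKey_injective tie)

theorem orderKey_add {m : ℕ} (tie : MonomialOrder (Fin m ⊕ Fin m))
    (a b : Fin m ⊕ Fin m →₀ ℕ) : orderKey tie (a + b) = orderKey tie a + orderKey tie b := by
  unfold orderKey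
  simp only [Finsupp.add_apply, Finset.sum_add_distrib, map_add]
  rfl

theorem orderKey_mono {m : ℕ} (tie : MonomialOrder (Fin m ⊕ Fin m)) :
    Monotone (orderKey tie) := by
  intro a b h
  have h1 : ∑ i, a (Sum.inr i) ≤ ∑ i, b (Sum.inr i) := Finset.sum_le_sum fun i _ => h (Sum.inr i)
  have h2 : ∑ i, a (Sum.inl i) ≤ ∑ i, b (Sum.inl i) := Finset.sum_le_sum fun i _ => h (Sum.inl i)
  apply Prod.Lex.toLex_mono
  refine Prod.mk_le_mk.mpr ⟨h1, ?_⟩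
  apply Prod.Lex.toLex_mono
  exact Prod.mk_le_mk.mpr ⟨h2, tie.toSyn_monotone h⟩

instance {m : ℕ} (tie : MonomialOrder (Fin m ⊕ Fin m)) : IsOrderedAddMonoid (OrderedExp tie) where
  add_le_add_left a b h c := by
    have h' : orderKey tie a ≤ orderKey tie b := h
    exact (orderKey_add tie a c).trans_le
      ((add_le_add_left h' (orderKey tie c)).trans_eq (orderKey_add tie b c).symm)

instance {m : ℕ} (tie : MonomialOrder (Fin m ⊕ Fin m)) : WellFoundedLT (OrderedExp tie) where
  wf := InvImage.wf (orderKey tie) wellFounded_lt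

/-- The term order `<_{(0,1)}` with tie-breaking term order `tie`: monomials `x^α ξ^β` are
compared first by total `ξ`-degree, then by total `x`-degree, then by `tie`. -/
def zeroOneOrder {m : ℕ} (tie : MonomialOrder (Fin m ⊕ Fin m)) :
    MonomialOrder (Fin m ⊕ Fin m) where
  syn := OrderedExp tie
  toSyn :=
    { toFun := fun γ => γ
      invFun := fun γ => γ
      left_inv := fun _ => rfl
      right_inv := fun _ => rfl
      map_add' := fun _ _ => rfl }
  toSyn_monotone := fun _ _ h => orderKey_mono tie h

open scoped MonomialOrder in
theorem zeroOneOrder_lt_iff {m : ℕ} (tie : MonomialOrder (Fin m ⊕ Fin m))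
    (a b : Fin m ⊕ Fin m →₀ ℕ) :
    a ≺[zeroOneOrder tie] b ↔
      (∑ i, a (Sum.inr i) < ∑ i, b (Sum.inr i)) ∨
      (∑ i, a (Sum.inr i) = ∑ i, b (Sum.inr i) ∧
        ∑ i, a (Sum.inl i) < ∑ i, b (Sum.inl i)) ∨
      (∑ i, a (Sum.inr i) = ∑ i, b (Sum.inr i) ∧
        ∑ i, a (Sum.inl i) = ∑ i, b (Sum.inl i) ∧ a ≺[tie] b) := by
  change orderKey tie a < orderKey tie b ↔ _
  unfold orderKey
  rw [Prod.Lex.toLex_lt_toLex, Prod.Lex.toLex_lt_toLex]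
  tauto

/-! ## Lauricella's system `F_B` -/

/-- `ℓᵢ^B = θᵢ (θ₁ + ⋯ + θₘ + c - 1) - xᵢ (θᵢ + aᵢ) (θᵢ + bᵢ)`. -/
def ellB {m : ℕ} (a b : Fin m → ℂ) (c : ℂ) (i : Fin m) : Weyl m :=
  theta i * ((∑ j, theta j) + algebraMap ℂ (Weyl m) (c - 1))
    - x i * (theta i + algebraMap ℂ (Weyl m) (a i)) * (theta i + algebraMap ℂ (Weyl m) (b i))

/-- The left ideal `I_B(m)` generated by `ℓ₁^B, …, ℓₘ^B`. -/
def idealB {m : ℕ} (a b : Fin m → ℂ) (c : ℂ) : Ideal (Weyl m) :=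
  Ideal.span (Set.range (ellB a b c))

end Lauricella

end

namespace Lauricella

open MvPolynomial
open scoped MonomialOrder

noncomputable section

/-! ## Operators with prescribed support -/

/-! Under the given order the leading term of `ℓᵢ` is `-xᵢ³ξᵢ²`, coming from `-xᵢθᵢ²`, so the
leading monomials are pairwise coprime. In the Weyl algebra coprimality alone does not make a
Gröbner basis, since the generators need not commute. The missing input is the twisted commutation
`(ℓᵢ - θᵢ) ℓⱼ = (ℓⱼ - θⱼ) ℓᵢ` (`ellB_sub_theta_mul_ellB`), in which `ℓᵢ - θᵢ` has the same leading
term as `ℓᵢ`. It holds because `E = θ₁ + ⋯ + θₘ + c - 1` satisfies `E xᵢ = xᵢ (E + 1)`, and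
subtracting `θᵢ` cancels exactly the terms produced by this shift.

With this relation every element of the ideal can be rewritten as `∑ Qᵢ ℓᵢ` in which no monomial of
`Qᵢ` is divisible by the leading monomial of an earlier `ℓⱼ`
(`monomialOp_mul_mem_reducedCombinations`). By coprimality the nonzero summands then have distinct
leading monomials, so nothing cancels at the top and the leading monomial of the sum is a multiple
of that of some `ℓᵢ` (`exists_degree_eq_of_mem_reducedCombinations`). Neither step depends on the
values of the parameters. -/

theorem symbol_monomialOp {m : ℕ} (γ : Fin m ⊕ Fin m →₀ ℕ) :
    symbol (monomialOp γ) = monomial γ (1 : ℂ) := by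
  apply normalOrder_injective
  rw [normalOrder_symbol, normalOrder_monomial, one_smul]

/-- The operators whose normally ordered expression only involves exponents in `S`. -/
def supportedOps {m : ℕ} (S : Set (Fin m ⊕ Fin m →₀ ℕ)) : Submodule ℂ (Weyl m) :=
  (restrictSupport ℂ S).comap (symbol : Weyl m ≃ₗ[ℂ] _).toLinearMap

theorem mem_supportedOps_iff {m : ℕ} {S : Set (Fin m ⊕ Fin m →₀ ℕ)} {P : Weyl m} :
    P ∈ supportedOps S ↔ ∀ γ ∈ (symbol P).support, γ ∈ S := Iff.rfl

theorem monomialOp_mem_supportedOps {m : ℕ} {S : Set (Fin m ⊕ Fin m →₀ ℕ)}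
    {γ : Fin m ⊕ Fin m →₀ ℕ} (h : γ ∈ S) : monomialOp γ ∈ supportedOps S := by
  change symbol (monomialOp γ) ∈ restrictSupport ℂ S
  rw [symbol_monomialOp, monomial_mem_restrictSupport]
  exact Or.inl h

theorem eq_sum_monomialOp {m : ℕ} (P : Weyl m) :
    P = ∑ γ ∈ (symbol P).support, coeff γ (symbol P) • monomialOp γ := by
  conv_lhs => rw [← normalOrder_symbol P, (symbol P).as_sum]
  rw [map_sum]
  exact Finset.sum_congr rfl fun γ _ => normalOrder_monomial _ _

/-- Normally ordered monomials span, so linear containments can be checked on them; this is the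
extension principle behind the estimates below. -/
theorem supportedOps_le {m : ℕ} {S : Set (Fin m ⊕ Fin m →₀ ℕ)} {N : Submodule ℂ (Weyl m)}
    (h : ∀ γ ∈ S, monomialOp γ ∈ N) : supportedOps S ≤ N := by
  intro P hP
  rw [eq_sum_monomialOp P]
  exact Submodule.sum_mem _ fun γ hγ => Submodule.smul_mem _ _ (h γ (hP hγ))

theorem supportedOps_mono {m : ℕ} {S T : Set (Fin m ⊕ Fin m →₀ ℕ)} (h : S ⊆ T) :
    supportedOps S ≤ supportedOps T :=
  supportedOps_le fun _ hγ => monomialOp_mem_supportedOps (h hγ)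

/-- The operators all of whose monomials are smaller than `γ`. -/
abbrev opsLT {m : ℕ} (ord : MonomialOrder (Fin m ⊕ Fin m))
    (γ : Fin m ⊕ Fin m →₀ ℕ) : Submodule ℂ (Weyl m) :=
  supportedOps {δ | δ ≺[ord] γ}

/-! ## Products of normally ordered monomials -/

theorem x_mul_monomialOp {m : ℕ} (i : Fin m) (γ : Fin m ⊕ Fin m →₀ ℕ) :
    x i * monomialOp γ = monomialOp (Finsupp.single (Sum.inl i) 1 + γ) := by
  classical
  unfold monomialOp
  rw [← mul_assoc, ← commPow_add_single]
  congr 2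
  · funext j
    simp [Finsupp.single_apply, Pi.single_apply, add_comm, eq_comm]
  · funext j
    simp

theorem del_mul_monomialOp {m : ℕ} (i : Fin m) (γ : Fin m ⊕ Fin m →₀ ℕ) :
    del i * monomialOp γ = monomialOp (Finsupp.single (Sum.inr i) 1 + γ)
      + (γ (Sum.inl i) : ℂ) • monomialOp (γ - Finsupp.single (Sum.inl i) 1) := by
  classical
  unfold monomialOp
  rw [← mul_assoc, del_mul_xPow, add_mul, mul_assoc, ← commPow_add_single, smul_mul_assoc]
  congr 1
  · congr 2
    · funext j
      simp
    · funext j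
      simp [Finsupp.single_apply, Pi.single_apply, add_comm, eq_comm]
  · congr 3
    · funext j
      simp [Finsupp.single_apply, Pi.single_apply, eq_comm]
    · funext j
      simp

/-- Left multiplication by `P` adds `γ` to the exponents of normally ordered monomials, up to
smaller monomials. -/
def ActsAsShift {m : ℕ} (ord : MonomialOrder (Fin m ⊕ Fin m)) (P : Weyl m)
    (γ : Fin m ⊕ Fin m →₀ ℕ) : Prop :=
  ∀ δ, ∃ R ∈ opsLT ord (γ + δ), P * monomialOp δ = monomialOp (γ + δ) + R

theorem ActsAsShift.mul_mem {m : ℕ} {ord : MonomialOrder (Fin m ⊕ Fin m)} {P : Weyl m}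
    {γ : Fin m ⊕ Fin m →₀ ℕ} (hP : ActsAsShift ord P γ) {δ : Fin m ⊕ Fin m →₀ ℕ} {Q : Weyl m}
    (hQ : Q ∈ opsLT ord δ) : P * Q ∈ opsLT ord (γ + δ) := by
  have h : opsLT ord δ ≤ (opsLT ord (γ + δ)).comap (LinearMap.mulLeft ℂ P) := by
    apply supportedOps_le
    intro ε hε
    have hlt : γ + ε ≺[ord] γ + δ := by
      rw [map_add, map_add]
      exact add_lt_add_right hε _
    obtain ⟨R, hR, h1⟩ := hP ε
    change P * monomialOp ε ∈ opsLT ord (γ + δ)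
    rw [h1]
    exact Submodule.add_mem _ (monomialOp_mem_supportedOps hlt)
      (supportedOps_mono (fun κ hκ => lt_trans hκ hlt) hR)
  exact h hQ

theorem ActsAsShift.mul {m : ℕ} {ord : MonomialOrder (Fin m ⊕ Fin m)} {P Q : Weyl m}
    {γ δ : Fin m ⊕ Fin m →₀ ℕ} (hP : ActsAsShift ord P γ) (hQ : ActsAsShift ord Q δ) :
    ActsAsShift ord (P * Q) (γ + δ) := by
  intro ε
  obtain ⟨R, hR, h1⟩ := hQ ε
  obtain ⟨R', hR', h2⟩ := hP (δ + ε)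
  rw [add_assoc]
  refine ⟨R' + P * R, Submodule.add_mem _ hR' (hP.mul_mem hR), ?_⟩
  rw [mul_assoc, h1, mul_add, h2, add_assoc]

theorem actsAsShift_one {m : ℕ} (ord : MonomialOrder (Fin m ⊕ Fin m)) :
    ActsAsShift ord 1 0 := by
  intro δ
  exact ⟨0, Submodule.zero_mem _, by rw [one_mul, zero_add, add_zero]⟩

theorem actsAsShift_x {m : ℕ} (ord : MonomialOrder (Fin m ⊕ Fin m)) (i : Fin m) :
    ActsAsShift ord (x i) (Finsupp.single (Sum.inl i) 1) := by
  intro δ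
  exact ⟨0, Submodule.zero_mem _, by rw [x_mul_monomialOp, add_zero]⟩

theorem actsAsShift_del {m : ℕ} (ord : MonomialOrder (Fin m ⊕ Fin m)) (i : Fin m) :
    ActsAsShift ord (del i) (Finsupp.single (Sum.inr i) 1) := by
  intro δ
  refine ⟨_, ?_, del_mul_monomialOp i δ⟩
  apply Submodule.smul_mem
  apply monomialOp_mem_supportedOps
  -- The correction from `[∂ᵢ, xᵢ] = 1` has an exponent dividing `δ`, hence strictly below the
  -- shifted one. If `xᵢ` does not occur, truncated subtraction leaves `δ` itself, and the bound
  -- still holds.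
  refine lt_of_le_of_lt (ord.toSyn_monotone tsub_le_self) (ord.toSyn_strictMono ?_)
  exact lt_add_of_pos_left _ (by simp [pos_iff_ne_zero])

theorem actsAsShift_commPow {m : ℕ} (ord : MonomialOrder (Fin m ⊕ Fin m)) (g : Fin m → Weyl m)
    (hg : ∀ i j, Commute (g i) (g j)) (e : Fin m → Fin m ⊕ Fin m)
    (h : ∀ i, ActsAsShift ord (g i) (Finsupp.single (e i) 1)) (α : Fin m → ℕ) :
    ActsAsShift ord (commPow g hg α) (∑ i, Finsupp.single (e i) (α i)) := by
  classical
  induction α using pi_nat_induction with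
  | h0 => simpa [commPow_zero] using actsAsShift_one ord
  | h1 α i ih =>
    have h1 := (h i).mul ih
    rw [← commPow_add_single] at h1
    convert h1 using 1
    simp only [Pi.add_apply, Finsupp.single_add, Finset.sum_add_distrib]
    rw [add_comm]
    congr 1
    rw [Finset.sum_eq_single i]
    · simp
    · intro j _ hj
      simp [hj]
    · simp

/-- Shifts compose, so the claim reduces to the generators `xᵢ` and `∂ᵢ`. Thus, for every term
order, normally ordered monomials multiply like commutative ones up to smaller terms. -/
theorem actsAsShift_monomialOp {m : ℕ} (ord : MonomialOrder (Fin m ⊕ Fin m))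
    (γ : Fin m ⊕ Fin m →₀ ℕ) : ActsAsShift ord (monomialOp γ) γ := by
  have h := (actsAsShift_commPow ord x x_commute Sum.inl (actsAsShift_x ord)
    (fun i => γ (Sum.inl i))).mul (actsAsShift_commPow ord del del_commute Sum.inr
      (actsAsShift_del ord) (fun i => γ (Sum.inr i)))
  rw [← Fintype.sum_sum_type (fun k => Finsupp.single k (γ k)),
    Finsupp.univ_sum_single] at h
  exact h

theorem mul_mem_supportedOps {m : ℕ} (ord : MonomialOrder (Fin m ⊕ Fin m))
    {S T U : Set (Fin m ⊕ Fin m →₀ ℕ)} {P Q : Weyl m} (hP : P ∈ supportedOps S)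
    (hQ : Q ∈ supportedOps T)
    (h : ∀ γ ∈ S, ∀ δ ∈ T, ∀ ε, ε ≼[ord] γ + δ → ε ∈ U) : P * Q ∈ supportedOps U := by
  have h1 : supportedOps S ≤ (supportedOps U).comap (LinearMap.mulRight ℂ Q) := by
    apply supportedOps_le
    intro γ hγ
    have h2 : supportedOps T ≤ (supportedOps U).comap (LinearMap.mulLeft ℂ (monomialOp γ)) := by
      apply supportedOps_le
      intro δ hδ
      obtain ⟨R, hR, h3⟩ := actsAsShift_monomialOp ord γ δ
      change monomialOp γ * monomialOp δ ∈ supportedOps U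
      rw [h3]
      exact Submodule.add_mem _ (monomialOp_mem_supportedOps (h γ hγ δ hδ _ le_rfl))
        (supportedOps_mono (fun κ hκ => h γ hγ δ hδ κ (le_of_lt hκ)) hR)
    exact h2 hQ
  exact h1 hP

/-! ## Leading terms -/

/-- The operator `P` is `c x^α ∂^β` plus smaller monomials, where `γ = (α, β)`. -/
def HasLeadingTerm {m : ℕ} (ord : MonomialOrder (Fin m ⊕ Fin m)) (P : Weyl m)
    (γ : Fin m ⊕ Fin m →₀ ℕ) (c : ℂ) : Prop :=
  ∃ R ∈ opsLT ord γ, P = c • monomialOp γ + R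

namespace HasLeadingTerm

variable {m : ℕ} {ord : MonomialOrder (Fin m ⊕ Fin m)} {P Q : Weyl m}
  {γ δ : Fin m ⊕ Fin m →₀ ℕ} {c d : ℂ}

theorem mem_supportedOps (h : HasLeadingTerm ord P γ c) :
    P ∈ supportedOps {ε | ε ≼[ord] γ} := by
  obtain ⟨R, hR, rfl⟩ := h
  exact Submodule.add_mem _ (Submodule.smul_mem _ _ (monomialOp_mem_supportedOps le_rfl))
    (supportedOps_mono (fun κ hκ => le_of_lt hκ) hR)

theorem mem_opsLT (h : HasLeadingTerm ord P γ c) (hlt : γ ≺[ord] δ) : P ∈ opsLT ord δ :=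
  supportedOps_mono (fun _ hκ => lt_of_le_of_lt hκ hlt) h.mem_supportedOps

theorem add_of_mem_opsLT (h : HasLeadingTerm ord P γ c) (hQ : Q ∈ opsLT ord γ) :
    HasLeadingTerm ord (P + Q) γ c := by
  obtain ⟨R, hR, rfl⟩ := h
  exact ⟨R + Q, Submodule.add_mem _ hR hQ, by rw [add_assoc]⟩

theorem smul (h : HasLeadingTerm ord P γ c) (d : ℂ) : HasLeadingTerm ord (d • P) γ (d * c) := by
  obtain ⟨R, hR, rfl⟩ := h
  exact ⟨d • R, Submodule.smul_mem _ _ hR, by rw [smul_add, smul_smul]⟩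

/-- Reordering creates only smaller monomials, and every product involving a lower-order remainder
is strictly smaller by compatibility of the order with addition. -/
theorem mul (hP : HasLeadingTerm ord P γ c) (hQ : HasLeadingTerm ord Q δ d) :
    HasLeadingTerm ord (P * Q) (γ + δ) (c * d) := by
  obtain ⟨R, hR, rfl⟩ := hP
  have h1 : R * Q ∈ opsLT ord (γ + δ) := by
    refine mul_mem_supportedOps ord hR hQ.mem_supportedOps fun ε hε κ hκ μ hμ => ?_
    refine lt_of_le_of_lt hμ ?_
    rw [map_add, map_add]
    exact add_lt_add_of_lt_of_le hε hκ
  obtain ⟨R', hR', rfl⟩ := hQ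
  obtain ⟨T, hT, h2⟩ := actsAsShift_monomialOp ord γ δ
  have h3 := (actsAsShift_monomialOp ord γ).mul_mem hR'
  refine ⟨(c * d) • T + c • (monomialOp γ * R') + R * (d • monomialOp δ + R'),
    Submodule.add_mem _ (Submodule.add_mem _ (Submodule.smul_mem _ _ hT)
      (Submodule.smul_mem _ _ h3)) h1, ?_⟩
  rw [add_mul, mul_add, smul_mul_smul_comm, h2, smul_add, smul_mul_assoc, ← add_assoc, ← add_assoc]

theorem mem_support (h : HasLeadingTerm ord P γ c) (hc : c ≠ 0) : γ ∈ (symbol P).support := by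
  obtain ⟨R, hR, rfl⟩ := h
  have h0 : coeff γ (symbol R) = 0 := by
    by_contra hne
    exact lt_irrefl _ (mem_supportedOps_iff.mp hR γ (mem_support_iff.mpr hne))
  rw [mem_support_iff, map_add, map_smul, symbol_monomialOp, coeff_add, coeff_smul,
    coeff_monomial, if_pos rfl, smul_eq_mul, mul_one, h0, add_zero]
  exact hc

theorem degree_eq (h : HasLeadingTerm ord P γ c) (hc : c ≠ 0) :
    ord.degree (symbol P) = γ := by
  apply ord.toSyn.injective
  apply le_antisymm
  · exact ord.degree_le_iff.mpr fun κ hκ => mem_supportedOps_iff.mp h.mem_supportedOps κ hκ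
  · exact ord.le_degree (h.mem_support hc)

theorem initialMonomial_eq (h : HasLeadingTerm ord P γ c) (hc : c ≠ 0) :
    initialMonomial ord P = monomial γ 1 := by
  have hP : P ≠ 0 := by
    rintro rfl
    simpa using h.mem_support hc
  rw [initialMonomial, if_neg hP, h.degree_eq hc]

end HasLeadingTerm

theorem hasLeadingTerm_monomialOp {m : ℕ} (ord : MonomialOrder (Fin m ⊕ Fin m))
    (γ : Fin m ⊕ Fin m →₀ ℕ) : HasLeadingTerm ord (monomialOp γ) γ 1 := by
  exact ⟨0, Submodule.zero_mem _, by rw [one_smul, add_zero]⟩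

/-- `P = 0` is allowed, with leading coefficient `0`, so products with vanishing `Qᵢ` need no
separate statement. -/
theorem hasLeadingTerm_degree {m : ℕ} (ord : MonomialOrder (Fin m ⊕ Fin m)) (P : Weyl m) :
    HasLeadingTerm ord P (ord.degree (symbol P)) (ord.leadingCoeff (symbol P)) := by
  classical
  by_cases hP : P = 0
  · subst hP
    exact ⟨0, Submodule.zero_mem _, by simp⟩
  have hmem := ord.degree_mem_support ((map_ne_zero_iff symbol symbol.injective).mpr hP)
  refine ⟨_, ?_, (eq_sum_monomialOp P).trans (Finset.add_sum_erase _ _ hmem).symm⟩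
  apply Submodule.sum_mem
  intro γ hγ
  apply Submodule.smul_mem
  apply monomialOp_mem_supportedOps
  exact lt_of_le_of_ne (ord.le_degree (Finset.mem_of_mem_erase hγ))
    fun he => Finset.ne_of_mem_erase hγ (ord.toSyn.injective he)

theorem monomialOp_zero {m : ℕ} : (monomialOp 0 : Weyl m) = 1 := by
  have h := commPow_zero (m := m) (x : Fin m → Weyl m) x_commute
  have h' := commPow_zero (m := m) (del : Fin m → Weyl m) del_commute
  exact (congrArg₂ (· * ·) h h').trans (one_mul 1)

theorem hasLeadingTerm_algebraMap {m : ℕ} (ord : MonomialOrder (Fin m ⊕ Fin m)) (c : ℂ) :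
    HasLeadingTerm ord (algebraMap ℂ (Weyl m) c) 0 c := by
  exact ⟨0, Submodule.zero_mem _, by
    rw [monomialOp_zero, Algebra.algebraMap_eq_smul_one, add_zero]⟩

theorem hasLeadingTerm_x {m : ℕ} (ord : MonomialOrder (Fin m ⊕ Fin m)) (i : Fin m) :
    HasLeadingTerm ord (x i) (Finsupp.single (Sum.inl i) 1) 1 := by
  have h := x_mul_monomialOp i 0
  rw [monomialOp_zero, mul_one, add_zero] at h
  rw [h]
  exact hasLeadingTerm_monomialOp ord _

theorem hasLeadingTerm_del {m : ℕ} (ord : MonomialOrder (Fin m ⊕ Fin m)) (i : Fin m) :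
    HasLeadingTerm ord (del i) (Finsupp.single (Sum.inr i) 1) 1 := by
  have h := del_mul_monomialOp i 0
  rw [monomialOp_zero, mul_one, add_zero, Finsupp.coe_zero, Pi.zero_apply, Nat.cast_zero,
    zero_smul, add_zero] at h
  rw [h]
  exact hasLeadingTerm_monomialOp ord _

/-! ## A Gröbner basis criterion -/

section Criterion

variable {m : ℕ} {ord : MonomialOrder (Fin m ⊕ Fin m)} {ι : Type*} [LinearOrder ι]
  [Fintype ι] {L s : ι → Weyl m} {u : ι → Fin m ⊕ Fin m →₀ ℕ} {c : ι → ℂ}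

/-- The exponents of monomials that are not divisible by any earlier leading monomial. -/
def reducedExps (u : ι → Fin m ⊕ Fin m →₀ ℕ) (i : ι) : Set (Fin m ⊕ Fin m →₀ ℕ) :=
  {γ | ∀ j < i, ¬ u j ≤ γ}

/-- The sums `∑ Qᵢ Lᵢ` where no monomial of `Qᵢ` is divisible by an earlier leading monomial. -/
def reducedCombinations (L : ι → Weyl m) (u : ι → Fin m ⊕ Fin m →₀ ℕ) : Submodule ℂ (Weyl m) :=
  ⨆ i, (supportedOps (reducedExps u i)).map (LinearMap.mulRight ℂ (L i))

/-- If an earlier `u j` divides `γ = δ + u j`, replace `monomialOp γ` by a multiple of `monomialOp δ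
* s j` plus smaller terms, and use `s j * L i = s i * L j`. The main part moves to the smaller index
`j` without raising the exponent bound; the error keeps the index `i` but has a smaller bound.
Lexicographic induction on (bound, index) terminates. -/
theorem monomialOp_mul_mem_reducedCombinations (hc : ∀ i, c i ≠ 0)
    (hs : ∀ i, HasLeadingTerm ord (s i) (u i) (c i))
    (hcomm : ∀ i j, s i * L j = s j * L i) (γ : Fin m ⊕ Fin m →₀ ℕ) (i : ι) :
    monomialOp γ * L i ∈ reducedCombinations L u := by
  -- The bound is an inequality because, after the index drops, the new monomials lie anywhere at or
  -- below the old top exponent.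
  suffices h : ∀ k : ord.syn, ∀ i γ, ord.toSyn (γ + u i) ≤ k →
      monomialOp γ * L i ∈ reducedCombinations L u from h _ i γ le_rfl
  intro k
  induction k using WellFoundedLT.induction with
  | ind k ihk =>
  intro i
  induction i using WellFoundedLT.induction with
  | ind i ihi =>
  intro γ hk
  by_cases hγ : γ ∈ reducedExps u i
  · exact Submodule.mem_iSup_of_mem i
      ⟨monomialOp γ, monomialOp_mem_supportedOps hγ, rfl⟩
  · obtain ⟨j, hji, hj⟩ : ∃ j < i, u j ≤ γ := by
      simpa [reducedExps] using hγ
    obtain ⟨δ, rfl⟩ : ∃ δ, γ = δ + u j := ⟨γ - u j, (tsub_add_cancel_of_le hj).symm⟩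
    have h1 := (hasLeadingTerm_monomialOp ord δ).mul (hs j)
    rw [one_mul] at h1
    obtain ⟨R, hR, h1⟩ := h1
    have h2 : monomialOp (δ + u j)
        = (c j)⁻¹ • (monomialOp δ * s j) + (-(c j)⁻¹) • R := by
      rw [h1, smul_add, smul_smul, inv_mul_cancel₀ (hc j), one_smul, add_assoc, ← add_smul,
        add_neg_cancel, zero_smul, add_zero]
    -- The error term: the bound strictly decreases, so the outer induction applies.
    have h3 : R * L i ∈ reducedCombinations L u := by
      have h : opsLT ord (δ + u j)
          ≤ (reducedCombinations L u).comap (LinearMap.mulRight ℂ (L i)) := by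
        apply supportedOps_le
        intro ε hε
        refine ihk (ord.toSyn (ε + u i)) (lt_of_lt_of_le ?_ hk) i ε le_rfl
        rw [map_add, map_add _ _ (u i)]
        exact add_lt_add_left hε _
      exact h hR
    -- The main term after the exchange: both tops equal `δ + u i + u j`, so the bound is kept and
    -- the index drops to `j < i`.
    have h4 : monomialOp δ * s i * L j ∈ reducedCombinations L u := by
      have h : supportedOps {ε | ε ≼[ord] δ + u i}
          ≤ (reducedCombinations L u).comap (LinearMap.mulRight ℂ (L j)) := by
        apply supportedOps_le
        intro ε hε
        refine ihi j hji ε (le_trans ?_ hk)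
        rw [add_right_comm, map_add, map_add _ _ (u j)]
        exact add_le_add_left hε _
      exact h ((hasLeadingTerm_monomialOp ord δ).mul (hs i)).mem_supportedOps
    rw [h2, add_mul, smul_mul_assoc, smul_mul_assoc, mul_assoc, hcomm j i, ← mul_assoc]
    exact Submodule.add_mem _ (Submodule.smul_mem _ _ h4) (Submodule.smul_mem _ _ h3)

theorem span_le_reducedCombinations (hc : ∀ i, c i ≠ 0)
    (hs : ∀ i, HasLeadingTerm ord (s i) (u i) (c i))
    (hcomm : ∀ i j, s i * L j = s j * L i) {P : Weyl m} (hP : P ∈ Ideal.span (Set.range L)) :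
    P ∈ reducedCombinations L u := by
  obtain ⟨Q, rfl⟩ := (Submodule.mem_span_range_iff_exists_fun _).mp hP
  refine Submodule.sum_mem _ fun i _ => ?_
  rw [smul_eq_mul, eq_sum_monomialOp (Q i), Finset.sum_mul]
  refine Submodule.sum_mem _ fun γ _ => ?_
  rw [smul_mul_assoc]
  exact Submodule.smul_mem _ _ (monomialOp_mul_mem_reducedCombinations hc hs hcomm γ i)

/-- In a reduced combination the leading monomials of distinct nonzero summands differ, so the
largest of them survives in the sum. -/
theorem exists_degree_eq_of_mem_reducedCombinations (hc : ∀ i, c i ≠ 0)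
    (hL : ∀ i, HasLeadingTerm ord (L i) (u i) (c i))
    (hcop : ∀ i j γ, i ≠ j → u j ≤ γ + u i → u j ≤ γ) {P : Weyl m} (hP0 : P ≠ 0)
    (hP : P ∈ reducedCombinations L u) :
    ∃ i γ, ord.degree (symbol P) = γ + u i := by
  classical
  obtain ⟨Q, hQ, rfl⟩ : ∃ Q : ι → Weyl m, (∀ i, Q i ∈ supportedOps (reducedExps u i)) ∧
      ∑ i, Q i * L i = P := by
    obtain ⟨f, hf, hsum⟩ := (Submodule.mem_iSup_iff_exists_finsupp _ _).mp hP
    choose Q hQ hQf using hf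
    refine ⟨Q, hQ, ?_⟩
    rw [← hsum, Finsupp.sum_fintype _ _ fun _ => rfl]
    exact Finset.sum_congr rfl fun i _ => hQf i
  set d : ι → Fin m ⊕ Fin m →₀ ℕ := fun i => ord.degree (symbol (Q i)) with hd
  have hlead : ∀ i, HasLeadingTerm ord (Q i * L i) (d i + u i)
      (ord.leadingCoeff (symbol (Q i)) * c i) :=
    fun i => (hasLeadingTerm_degree ord (Q i)).mul (hL i)
  have hne : (Finset.univ.filter fun i => Q i ≠ 0).Nonempty := by
    by_contra h
    rw [Finset.not_nonempty_iff_eq_empty, Finset.filter_eq_empty_iff] at h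
    apply hP0
    refine Finset.sum_eq_zero fun i hi => ?_
    rw [not_not.mp (h hi), zero_mul]
  obtain ⟨i, hi, hmax⟩ := Finset.exists_max_image _ (fun i => ord.toSyn (d i + u i)) hne
  have hi0 : Q i ≠ 0 := (Finset.mem_filter.mp hi).2
  have hred : ∀ j, Q j ≠ 0 → d j ∈ reducedExps u j := fun j hj =>
    hQ j (ord.degree_mem_support ((map_ne_zero_iff symbol symbol.injective).mpr hj))
  -- Equality would make `u j` divide `d k + u k`, hence `d k` by coprimality, contradicting that `Q
  -- k` is reduced.
  have hinj : ∀ j k, Q k ≠ 0 → j < k → d j + u j ≠ d k + u k := by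
    intro j k hk hjk he
    refine hred k hk j hjk (hcop k j _ hjk.ne' ?_)
    rw [← he]
    exact le_add_self
  have hrest : ∑ j ∈ Finset.univ.erase i, Q j * L j ∈ opsLT ord (d i + u i) := by
    refine Submodule.sum_mem _ fun j hj => ?_
    by_cases hj0 : Q j = 0
    · rw [hj0, zero_mul]
      exact Submodule.zero_mem _
    refine (hlead j).mem_opsLT (lt_of_le_of_ne
      (hmax j (Finset.mem_filter.mpr ⟨Finset.mem_univ j, hj0⟩)) fun he => ?_)
    have he' := ord.toSyn.injective he
    rcases lt_or_gt_of_ne (Finset.ne_of_mem_erase hj) with h | h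
    · exact hinj j i hi0 h he'
    · exact hinj i j hj0 h he'.symm
  refine ⟨i, d i, ?_⟩
  rw [← Finset.add_sum_erase _ _ (Finset.mem_univ i)]
  refine ((hlead i).add_of_mem_opsLT hrest).degree_eq (mul_ne_zero ?_ (hc i))
  exact ord.leadingCoeff_ne_zero_iff.mpr ((map_ne_zero_iff symbol symbol.injective).mpr hi0)

/-- Operators with pairwise coprime leading monomials form a Gröbner basis if their commutation
is governed by operators with the same leading terms. -/
theorem isGroebnerBasis_of_coprime (hc : ∀ i, c i ≠ 0)
    (hL : ∀ i, HasLeadingTerm ord (L i) (u i) (c i))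
    (hs : ∀ i, HasLeadingTerm ord (s i) (u i) (c i))
    (hcomm : ∀ i j, s i * L j = s j * L i)
    (hcop : ∀ i j γ, i ≠ j → u j ≤ γ + u i → u j ≤ γ) :
    IsGroebnerBasis ord (Set.range L) (Ideal.span (Set.range L)) where
  finite := Set.finite_range L
  span_eq := rfl
  initialIdeal_eq := by
    apply le_antisymm
    · apply Ideal.span_le.mpr
      rintro _ ⟨P, hP, rfl⟩
      by_cases hP0 : P = 0
      · rw [initialMonomial, if_pos hP0]
        exact Ideal.zero_mem _
      obtain ⟨i, γ, h⟩ := exists_degree_eq_of_mem_reducedCombinations hc hL hcop hP0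
        (span_le_reducedCombinations hc hs hcomm hP)
      have h1 : initialMonomial ord P = monomial γ 1 * initialMonomial ord (L i) := by
        rw [(hL i).initialMonomial_eq (hc i), monomial_mul, mul_one, initialMonomial, if_neg hP0, h]
      rw [h1]
      exact Ideal.mul_mem_left _ _ (Ideal.subset_span ⟨L i, ⟨i, rfl⟩, rfl⟩)
    · exact Ideal.span_mono (Set.image_mono Ideal.subset_span)

end Criterion

/-! ## Commutation of the operators `ℓᵢ^B` -/

theorem theta_mul_x_self {m : ℕ} (i : Fin m) :
    theta i * x i = x i * theta i + (x i : Weyl m) := by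
  apply weyl_ext
  intro f
  change X i * pderiv i (X i * f) = X i * (X i * pderiv i f) + X i * f
  rw [pderiv_mul, pderiv_X_self]
  ring

theorem theta_commute_x {m : ℕ} {i j : Fin m} (h : i ≠ j) :
    Commute (theta i : Weyl m) (x j) := by
  apply weyl_ext
  intro f
  change X i * pderiv i (X j * f) = X j * (X i * pderiv i f)
  rw [pderiv_mul, pderiv_X_of_ne h.symm]
  ring

theorem theta_commute_del {m : ℕ} {i j : Fin m} (h : i ≠ j) :
    Commute (theta i : Weyl m) (del j) := by
  refine Commute.mul_left ?_ (del_commute i j)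
  apply weyl_ext
  intro f
  change X i * pderiv j f = pderiv j (X i * f)
  rw [pderiv_mul, pderiv_X_of_ne h]
  ring

theorem theta_commute {m : ℕ} (i j : Fin m) : Commute (theta i : Weyl m) (theta j) := by
  by_cases h : i = j
  · rw [h]
  · exact (theta_commute_x h).mul_right (theta_commute_del h)

/-- The operator `θ₁ + ⋯ + θₘ + c - 1`. -/
def shiftedEuler (m : ℕ) (c : ℂ) : Weyl m := (∑ j, theta j) + algebraMap ℂ (Weyl m) (c - 1)

/-- Only the summand `θᵢ` fails to commute with `xᵢ`, and it contributes the extra `xᵢ`. -/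
theorem shiftedEuler_mul_x {m : ℕ} (c : ℂ) (i : Fin m) :
    shiftedEuler m c * x i = x i * shiftedEuler m c + x i := by
  have h : (∑ j ∈ Finset.univ.erase i, theta j) * x i
      = x i * ∑ j ∈ Finset.univ.erase i, (theta j : Weyl m) :=
    Commute.sum_left _ _ _ fun j hj => theta_commute_x (Finset.ne_of_mem_erase hj)
  rw [shiftedEuler, ← Finset.add_sum_erase _ _ (Finset.mem_univ i), add_mul, add_mul, h,
    theta_mul_x_self, mul_add, mul_add, Algebra.commutes (c - 1) (x i)]
  abel

theorem theta_commute_shiftedEuler {m : ℕ} (c : ℂ) (i : Fin m) :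
    Commute (theta i) (shiftedEuler m c) :=
  (Commute.sum_right _ _ _ fun j _ => theta_commute i j).add_right (Algebra.commutes _ _).symm

/-- The operator `(θᵢ + a) (θᵢ + b)`. -/
def thetaQuadratic {m : ℕ} (i : Fin m) (a b : ℂ) : Weyl m :=
  (theta i + algebraMap ℂ (Weyl m) a) * (theta i + algebraMap ℂ (Weyl m) b)

theorem commute_thetaQuadratic {m : ℕ} {P : Weyl m} {i : Fin m} (h : Commute P (theta i))
    (a b : ℂ) : Commute P (thetaQuadratic i a b) :=
  (h.add_right (Algebra.commutes _ _).symm).mul_right (h.add_right (Algebra.commutes _ _).symm)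

theorem ellB_eq {m : ℕ} (a b : Fin m → ℂ) (c : ℂ) (i : Fin m) :
    ellB a b c i = (-1 : ℂ) • (x i * thetaQuadratic i (a i) (b i))
      + theta i * shiftedEuler m c := by
  apply weyl_ext
  intro f
  rw [ellB, mul_assoc]
  change (theta i * shiftedEuler m c).1 f - (x i * thetaQuadratic i (a i) (b i)).1 f
    = (-1 : ℂ) • (x i * thetaQuadratic i (a i) (b i)).1 f + (theta i * shiftedEuler m c).1 f
  rw [neg_one_smul, neg_add_eq_sub]

/-- Here `t, u` stand for `θᵢ, θⱼ`, `X, Y` for `xᵢ, xⱼ`, and `S, T` for the two quadratics. Moving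
`E` past `Y` turns `tE·YT` into `YT·tE + t·YT`; the term `-t` in the first factor cancels the excess
`t·YT`. What remains is symmetric under exchanging the two index families. -/
theorem mul_comm_of_shift {A : Type*} [Semiring A] [Algebra ℂ A] {t u X Y E S T : A}
    (htu : Commute t u) (htE : Commute t E) (huE : Commute u E) (htY : Commute t Y)
    (huX : Commute u X) (hXY : Commute X Y) (htT : Commute t T) (huS : Commute u S)
    (hSE : Commute E S) (hTE : Commute E T) (hST : Commute S T) (hSY : Commute Y S)
    (hTX : Commute X T) (hEX : E * X = X * E + X) (hEY : E * Y = Y * E + Y) :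
    (((-1 : ℂ) • (X * S) + t * E) + (-1 : ℂ) • t) * ((-1 : ℂ) • (Y * T) + u * E)
      = (((-1 : ℂ) • (Y * T) + u * E) + (-1 : ℂ) • u) * ((-1 : ℂ) • (X * S) + t * E) := by
  -- Stated generally because it serves twice, once for each order of the two indices.
  have key : ∀ {t Y T : A}, Commute t E → Commute t Y → Commute t T → Commute E T →
      E * Y = Y * E + Y → t * E * (Y * T) = Y * T * (t * E) + t * (Y * T) := by
    intro t Y T htE htY htT hTE hEY
    have h : E * (Y * T) = Y * T * E + Y * T := by
      rw [← mul_assoc, hEY, add_mul, mul_assoc, hTE.eq, mul_assoc]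
    rw [mul_assoc, h, mul_add, ← mul_assoc t, (htY.mul_right htT).eq, mul_assoc _ t]
  have h1 := key htE htY htT hTE hEY
  have h2 := key huE huX huS hSE hEX
  have h3 : X * S * (Y * T) = Y * T * (X * S) :=
    ((hXY.mul_right hTX).mul_left (hSY.symm.mul_right hST)).eq
  have h4 : t * E * (u * E) = u * E * (t * E) :=
    ((htu.mul_right htE).mul_left (huE.symm.mul_right (Commute.refl E))).eq
  have h5 : t * (u * E) = u * (t * E) := htu.left_comm E
  simp only [add_mul, mul_add, smul_mul_assoc, mul_smul_comm, h1, h2, h3, h4, h5]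
  module

/-! ## Leading terms of the operators `ℓᵢ^B` -/

/-- The exponent of `xᵢ³ ξᵢ²`. -/
def leadExp {m : ℕ} (i : Fin m) : Fin m ⊕ Fin m →₀ ℕ :=
  Finsupp.single (Sum.inl i) 3 + Finsupp.single (Sum.inr i) 2

/-- The exponent of `xᵢ ξᵢ`. -/
def thetaExp {m : ℕ} (i : Fin m) : Fin m ⊕ Fin m →₀ ℕ :=
  Finsupp.single (Sum.inl i) 1 + Finsupp.single (Sum.inr i) 1

theorem leadExp_eq {m : ℕ} (i : Fin m) :
    leadExp i = Finsupp.single (Sum.inl i) 1 + (thetaExp i + thetaExp i) := by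
  unfold leadExp thetaExp
  rw [show (3 : ℕ) = 1 + (1 + 1) from rfl, show (2 : ℕ) = 1 + 1 from rfl]
  simp only [Finsupp.single_add]
  abel

theorem hasLeadingTerm_theta {m : ℕ} (ord : MonomialOrder (Fin m ⊕ Fin m)) (i : Fin m) :
    HasLeadingTerm ord (theta i) (thetaExp i) 1 := by
  have h := (hasLeadingTerm_x ord i).mul (hasLeadingTerm_del ord i)
  rwa [one_mul] at h

theorem hasLeadingTerm_theta_add {m : ℕ} (ord : MonomialOrder (Fin m ⊕ Fin m)) (i : Fin m)
    (a : ℂ) : HasLeadingTerm ord (theta i + algebraMap ℂ (Weyl m) a) (thetaExp i) 1 := by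
  refine (hasLeadingTerm_theta ord i).add_of_mem_opsLT
    ((hasLeadingTerm_algebraMap ord a).mem_opsLT (ord.toSyn_strictMono ?_))
  simp [pos_iff_ne_zero, thetaExp]

theorem hasLeadingTerm_x_mul_thetaQuadratic {m : ℕ} (ord : MonomialOrder (Fin m ⊕ Fin m))
    (i : Fin m) (a b : ℂ) :
    HasLeadingTerm ord (x i * thetaQuadratic i a b) (leadExp i) 1 := by
  have h := (hasLeadingTerm_x ord i).mul
    ((hasLeadingTerm_theta_add ord i a).mul (hasLeadingTerm_theta_add ord i b))
  rw [one_mul, one_mul] at h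
  rwa [← leadExp_eq] at h

theorem thetaExp_lt_leadExp {m : ℕ} (tie : MonomialOrder (Fin m ⊕ Fin m)) (i : Fin m) :
    thetaExp i ≺[zeroOneOrder tie] leadExp i := by
  rw [zeroOneOrder_lt_iff]
  left
  simp [thetaExp, leadExp, Finsupp.single_apply]

/-- Both sides have `ξ`-degree 2, so the `x`-degree decides, 2 against 3; `tie` is never consulted.
-/
theorem thetaExp_add_lt_leadExp {m : ℕ} (tie : MonomialOrder (Fin m ⊕ Fin m)) (i j : Fin m) :
    thetaExp i + thetaExp j ≺[zeroOneOrder tie] leadExp i := by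
  rw [zeroOneOrder_lt_iff]
  right
  left
  simp [thetaExp, leadExp, Finsupp.single_apply, Finset.sum_add_distrib]

theorem theta_mul_shiftedEuler_mem {m : ℕ} (tie : MonomialOrder (Fin m ⊕ Fin m)) (c : ℂ)
    (i : Fin m) : theta i * shiftedEuler m c ∈ opsLT (zeroOneOrder tie) (leadExp i) := by
  rw [shiftedEuler, mul_add, Finset.mul_sum]
  refine Submodule.add_mem _ (Submodule.sum_mem _ fun j _ => ?_) ?_
  · exact ((hasLeadingTerm_theta _ i).mul (hasLeadingTerm_theta _ j)).mem_opsLT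
      (thetaExp_add_lt_leadExp tie i j)
  · refine ((hasLeadingTerm_theta _ i).mul (hasLeadingTerm_algebraMap _ _)).mem_opsLT ?_
    rw [add_zero]
    exact thetaExp_lt_leadExp tie i

theorem hasLeadingTerm_ellB {m : ℕ} (tie : MonomialOrder (Fin m ⊕ Fin m)) (a b : Fin m → ℂ)
    (c : ℂ) (i : Fin m) :
    HasLeadingTerm (zeroOneOrder tie) (ellB a b c i) (leadExp i) (-1) := by
  rw [ellB_eq]
  have h := (hasLeadingTerm_x_mul_thetaQuadratic (zeroOneOrder tie) i (a i) (b i)).smul (-1)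
  rw [mul_one] at h
  exact h.add_of_mem_opsLT (theta_mul_shiftedEuler_mem tie c i)

theorem hasLeadingTerm_ellB_sub_theta {m : ℕ} (tie : MonomialOrder (Fin m ⊕ Fin m))
    (a b : Fin m → ℂ) (c : ℂ) (i : Fin m) :
    HasLeadingTerm (zeroOneOrder tie) (ellB a b c i + (-1 : ℂ) • theta i) (leadExp i) (-1) :=
  (hasLeadingTerm_ellB tie a b c i).add_of_mem_opsLT (Submodule.smul_mem _ _
    ((hasLeadingTerm_theta _ i).mem_opsLT (thetaExp_lt_leadExp tie i)))

theorem ellB_sub_theta_mul_ellB {m : ℕ} (a b : Fin m → ℂ) (c : ℂ) (i j : Fin m) :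
    (ellB a b c i + (-1 : ℂ) • theta i) * ellB a b c j
      = (ellB a b c j + (-1 : ℂ) • theta j) * ellB a b c i := by
  -- The diagonal case is trivial but must be split off: the abstract identity needs `θⱼ` to commute
  -- with `xᵢ`.
  by_cases hij : i = j
  · rw [hij]
  rw [ellB_eq, ellB_eq]
  exact mul_comm_of_shift (theta_commute i j) (theta_commute_shiftedEuler c i)
    (theta_commute_shiftedEuler c j) (theta_commute_x hij) (theta_commute_x (Ne.symm hij))
    (x_commute i j) (commute_thetaQuadratic (theta_commute i j) _ _)
    (commute_thetaQuadratic (theta_commute j i) _ _)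
    (commute_thetaQuadratic (theta_commute_shiftedEuler c i).symm _ _)
    (commute_thetaQuadratic (theta_commute_shiftedEuler c j).symm _ _)
    (commute_thetaQuadratic (commute_thetaQuadratic (theta_commute j i) _ _).symm _ _)
    (commute_thetaQuadratic (theta_commute_x hij).symm _ _)
    (commute_thetaQuadratic (theta_commute_x (Ne.symm hij)).symm _ _)
    (shiftedEuler_mul_x c i) (shiftedEuler_mul_x c j)

/-- For `i ≠ j` the two leading monomials involve disjoint sets of variables. -/
theorem leadExp_le_of_le_add {m : ℕ} (i j : Fin m) (γ : Fin m ⊕ Fin m →₀ ℕ) (hij : i ≠ j)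
    (h : leadExp j ≤ γ + leadExp i) : leadExp j ≤ γ := by
  intro k
  have hk := h k
  simp only [leadExp, Finsupp.add_apply, Finsupp.single_apply] at hk ⊢
  rcases k with k | k
  · by_cases hjk : j = k
    · subst hjk
      simpa [hij] using hk
    · simp [hjk]
  · by_cases hjk : j = k
    · subst hjk
      simpa [hij] using hk
    · simp [hjk]

end

end Lauricella

theorem mainTheorem3 {m : ℕ} (a b : Fin m → ℂ) (c : ℂ)
    (tie : MonomialOrder (Fin m ⊕ Fin m)) :
    Lauricella.IsGroebnerBasis (Lauricella.zeroOneOrder tie)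
      (Set.range (Lauricella.ellB a b c)) (Lauricella.idealB a b c) :=
  Lauricella.isGroebnerBasis_of_coprime (c := fun _ => -1)
    (fun _ => neg_ne_zero.mpr one_ne_zero)
    (Lauricella.hasLeadingTerm_ellB tie a b c) (Lauricella.hasLeadingTerm_ellB_sub_theta tie a b c)
    (Lauricella.ellB_sub_theta_mul_ellB a b c) Lauricella.leadExp_le_of_le_add
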